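/- Let $k,n,m,p,q\ge 0$ be integers. For $\mathbf H:\{0,1\}^k\times\{0,1\}^n\to\{0,1\}^m$ define, for $K_1\in\{0,1\}^k$, $K_2\in\{0,1\}^n$, $x\in\{0,1\}^n$, $$\mathsf{FFX}[\mathbf H](K_1\,\|\,K_2,x)=\mathbf H(K_1,\,x\oplus K_2).$$ For a bit $b$, the PRF game $\mathsf G_b(\mathcal A)$ samples, uniformly and independently, a random oracle $\mathbf H:\{0,1\}^k\times\{0,1\}^n\to\{0,1\}^m$, a key $K\in\{0,1\}^{k+n}$ and a function $F:\{0,1\}^n\to\{0,1\}^m$, runs $\mathcal A$ with access to two oracles, and returns true if $\mathcal A$ outputs $1$. The oracles are * the random oracle $|K',X,Y\rangle\mapsto|K',X,\mathbf H(K',X)\oplus Y\rangle$, which may be queried in quantum superposition; * the construction oracle $\mathsf{Ev}:|X,Y\rangle\mapsto|X,Y_b(X)\oplus Y\rangle$ with $Y_1(X)=\mathsf{FFX}[\mathbf H](K,X)$ and $Y_0(X)=F(X)$, which may only be queried classically: the register $X$ is measured in the computational basis immediately before each query. The adversary $\mathcal A$ is an adaptive quantum algorithm with finitely many qubits, initially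 all in state $|0\rangle$. Between queries it may apply arbitrary quantum operations (unitaries, measurements) to its own registers and let its further behaviour depend on the measurement outcomes; its output is obtained by measuring a designated qubit at the end. It is \emph{order consistent} if the sequence in which it queries the two oracles is fixed before the execution. Put $\mathsf{Adv}^{\mathsf{prf}}_{\mathsf{FFX}}(\mathcal A)=\Pr[\mathsf G_1(\mathcal A)]-\Pr[\mathsf G_0(\mathcal A)]$. **Theorem.** If $\mathcal A$ is order consistent and makes $p$ (quantum) queries to the random oracle and $q$ (classical, adaptive) queries to $\mathsf{Ev}$, then $$\mathsf{Adv}^{\mathsf{prf}}_{\mathsf{FFX}}(\mathcal A)\le\sqrt{\frac{8(p+q)\,p\,q}{2^{k+n}}}.$$ -/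

import Mathlib

open scoped BigOperators Matrix

/-- Bit strings of length `n`. A bit is an element of `ZMod 2`, so `x + y` is the bitwise xor. -/
abbrev Bits (n : ℕ) : Type := Fin n → ZMod 2

/-- `Fcs k n m`: all functions `{0,1}^k × {0,1}^n → {0,1}^m` (curried). -/
abbrev Fcs (k n m : ℕ) : Type := Bits k → Bits n → Bits m

theorem Bits.add_add_cancel {n : ℕ} (x y : Bits n) : x + (x + y) = y := by
  funext i
  simp [← add_assoc, CharTwo.add_self_eq_zero]

/-- A function family with key length `kl`, input length `il` and output length `ol`,
constructed from an oracle in `Fcs k n m`. -/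
abbrev FunctionFamily (k n m kl il ol : ℕ) : Type := Fcs k n m → Fcs kl il ol

/-- `FFX[H](K₁ ‖ K₂, x) = H_{K₁}(x ⊕ K₂)`, where `K₁` is the first `k` bits and `K₂` the last
`n` bits of the key. -/
def FFX (k n m : ℕ) : FunctionFamily k n m (k + n) n m :=
  fun H K x => H (fun i => K (Fin.castAdd n i)) (x + fun j => K (Fin.natAdd k j))

/-- Computational basis states of the registers of an adversary: a workspace of `w + 1` qubits
(whose qubit `0` receives the output), the registers `(K, X, Y)` used for queries to the random
oracle, and the registers `(X', Y')` used for queries to the construction oracle `Ev`. -/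
abbrev Reg (w k n m il ol : ℕ) : Type :=
  Bits (w + 1) × (Bits k × Bits n × Bits m) × (Bits il × Bits ol)

instance (w k n m il ol : ℕ) : DecidableEq (Reg w k n m il ol) :=
  @instDecidableEqProd _ _ inferInstance
    (@instDecidableEqProd _ _ (@instDecidableEqProd _ _ inferInstance inferInstance) inferInstance)

/-- (Possibly unnormalized) state vectors of the registers, as amplitude functions. -/
abbrev QState (w k n m il ol : ℕ) : Type := Reg w k n m il ol → ℂ

/-- The two oracles: the random oracle and the construction oracle. -/
inductive Oracle : Type where
  | ro : Oracle
  | ev : Oracle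
  deriving DecidableEq

/-- An adaptive quantum adversary, given as its (finite) tree of behaviours.

* `halt`: stop (qubit `0` of the workspace is then measured to obtain the output bit);
* `act V hV next`: apply the quantum operation with outcomes `i : Fin r` and Kraus operators `V i`
  to the adversary's own registers and continue with `next i` after outcome `i`. Unitaries
  (`r = 1`) and measurements of any of the qubits in the computational basis are special cases;
* `roQuery next`: query the random oracle, in superposition;
* `evQuery next`: query the construction oracle `Ev`, classically. -/
inductive Adversary (w k n m il ol : ℕ) : Type where
  | halt : Adversary w k n m il ol
  | act {r : ℕ} (V : Fin r → Matrix (Reg w k n m il ol) (Reg w k n m il ol) ℂ)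
      (hV : ∑ i, (V i)ᴴ * V i = 1) (next : Fin r → Adversary w k n m il ol) :
      Adversary w k n m il ol
  | roQuery (next : Adversary w k n m il ol) : Adversary w k n m il ol
  | evQuery (next : Adversary w k n m il ol) : Adversary w k n m il ol

namespace Adversary

variable {w k n m il ol : ℕ}

/-- `A.QueriesInOrder s`: in every execution, whatever the outcomes of the measurements, the
sequence of oracles that `A` queries is exactly `s`. -/
def QueriesInOrder : Adversary w k n m il ol → List Oracle → Prop
  | halt, s => s = []
  | act _ _ next, s => ∀ i, (next i).QueriesInOrder s
  | roQuery next, s => ∃ t, s = Oracle.ro :: t ∧ next.QueriesInOrder t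
  | evQuery next, s => ∃ t, s = Oracle.ev :: t ∧ next.QueriesInOrder t

/-- `A` is order consistent, making `p` queries to the random oracle and `q` queries to `Ev`:
the order in which it alternates between its oracles is fixed before the execution. -/
def OrderConsistent (A : Adversary w k n m il ol) (p q : ℕ) : Prop :=
  ∃ s : List Oracle, A.QueriesInOrder s ∧ s.count Oracle.ro = p ∧ s.count Oracle.ev = q

end Adversary

section Oracles

variable {w k n m il ol : ℕ}

/-- The random oracle as a permutation of basis states: `(K, X, Y) ↦ (K, X, H_K(X) ⊕ Y)`. -/
def roPerm (H : Fcs k n m) : Equiv.Perm (Reg w k n m il ol) where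
  toFun := fun ⟨W, ⟨K, X, Y⟩, E⟩ => ⟨W, ⟨K, X, H K X + Y⟩, E⟩
  invFun := fun ⟨W, ⟨K, X, Y⟩, E⟩ => ⟨W, ⟨K, X, H K X + Y⟩, E⟩
  left_inv := fun ⟨W, ⟨K, X, Y⟩, E⟩ => by simp only [Bits.add_add_cancel]
  right_inv := fun ⟨W, ⟨K, X, Y⟩, E⟩ => by simp only [Bits.add_add_cancel]

/-- The construction oracle for the function `f`: `(X', Y') ↦ (X', f(X') ⊕ Y')`. -/
def evPerm (f : Bits il → Bits ol) : Equiv.Perm (Reg w k n m il ol) where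
  toFun := fun ⟨W, R, ⟨X, Y⟩⟩ => ⟨W, R, ⟨X, f X + Y⟩⟩
  invFun := fun ⟨W, R, ⟨X, Y⟩⟩ => ⟨W, R, ⟨X, f X + Y⟩⟩
  left_inv := fun ⟨W, R, ⟨X, Y⟩⟩ => by simp only [Bits.add_add_cancel]
  right_inv := fun ⟨W, R, ⟨X, Y⟩⟩ => by simp only [Bits.add_add_cancel]

/-- The unitary `|r⟩ ↦ |P r⟩` of a permutation `P` of the basis states. -/
def applyPerm (P : Equiv.Perm (Reg w k n m il ol)) (ψ : QState w k n m il ol) :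
    QState w k n m il ol :=
  fun r => ψ (P.symm r)

/-- The unnormalized state after measuring the input register `X'` of `Ev` with outcome `x`. -/
def projectEvInput (x : Bits il) (ψ : QState w k n m il ol) : QState w k n m il ol :=
  fun r => if r.2.2.1 = x then ψ r else 0

/-- The all-zeros initial state `|0…0⟩`. -/
def initState : QState w k n m il ol := fun r => if r = 0 then 1 else 0

/-- The probability that an adversary, started in the state `ψ` with random oracle `H` and
construction oracle `f`, outputs `1`. States are kept unnormalized: the squared norm of the current
vector is the probability of the sequence of measurement outcomes observed so far, and one sums
over all outcomes. A query to `Ev` measures the input register immediately before the query, so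
that it is classical. -/
noncomputable def acceptProb (H : Fcs k n m) (f : Bits il → Bits ol) :
    Adversary w k n m il ol → QState w k n m il ol → ℝ
  | .halt, ψ => ∑ r, if r.1 0 = 1 then ‖ψ r‖ ^ 2 else 0
  | .act V _ next, ψ => ∑ i, acceptProb H f (next i) (V i *ᵥ ψ)
  | .roQuery next, ψ => acceptProb H f next (applyPerm (roPerm H) ψ)
  | .evQuery next, ψ =>
      ∑ x : Bits il, acceptProb H f next (applyPerm (evPerm f) (projectEvInput x ψ))

end Oracles

section Game

variable {w k n m kl il ol : ℕ}

/-- The probability that the PRF game for the family `𝓕` with challenge bit `b` returns true: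
the random oracle `H`, the key `K` and the random function `F` are sampled uniformly and
independently, and `Ev` answers with `𝓕[H](K, ·)` if `b = 1` and with `F` if `b = 0`. -/
noncomputable def prfGame (𝓕 : FunctionFamily k n m kl il ol) (b : Bool)
    (A : Adversary w k n m il ol) : ℝ :=
  Finset.expect Finset.univ fun H : Fcs k n m =>
    Finset.expect Finset.univ fun K : Bits kl =>
      Finset.expect Finset.univ fun F : Bits il → Bits ol =>
        acceptProb H (if b then 𝓕 H K else F) A initState

/-- The PRF advantage `Pr[G₁] - Pr[G₀]`. -/
noncomputable def prfAdvantage (𝓕 : FunctionFamily k n m kl il ol)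
    (A : Adversary w k n m il ol) : ℝ :=
  prfGame 𝓕 true A - prfGame 𝓕 false A

end Game

/-!
Write `N = 2 ^ (k + n)`. The real and the ideal game are joined by hybrids that keep the key out of
the adversary's state for as long as possible. In the hybrid with `j` answered `Ev`-queries on the
inputs `S`, the adversary has so far interacted with the ideal game, whose oracles `H` and `F` do
not involve the key `K`; from here on it runs the real game for the oracle `reprogram K S (H, F)`,
which is `H` with the values at the points `keyPoint K x`, `x ∈ S`, replaced by `F x`. With `S`
empty and nothing executed this is the real game; with everything executed it is the ideal game.
Two kinds of steps lead from one hybrid to the next.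

* A query to the random oracle is answered by `H` instead of the reprogrammed oracle
  (`hybridSum_roQuery_le`). As `K` is uniform and independent of the state, the mean squared weight
  on the at most `q` reprogrammed points is at most `q / N`, and the step costs `2 √(q / N)`.
* A query to `Ev` on a new input `x` is answered by `F x` instead of the random oracle at
  `z = keyPoint K x`, which is then reprogrammed (`hybridSum_evQuery_branch_le`). Exchanging the
  independent uniform values `H z` and `F x` shows that this amounts to running the first phase with
  the value of `H` at `z` resampled. For a uniform `z`, the mean squared change of the state is its
  total influence divided by `N`. Each earlier query to the random oracle has raised the total
  influence by at most `4` (`Family.influence_roQuery_le`), since on the part of the state with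
  input `z` only the dependence on `H z` changes. The step costs `2 √(p / N)`.

Together `2 p √(q / N) + 2 q √(p / N) ≤ √(8 (p + q) p q / N)`.

A distance `δ` of unit vectors costs at most `δ` in acceptance probability, with no factor `2`,
because the vectors have the same norm (`acceptProb_sub_le_aux`). To sum over measurement outcomes
without losing on square roots, every bound `√(a b)` is kept in the linear form `c a / 4 + b / c`,
with the same `c` throughout (one for each kind of step), and `c` is optimised at the end
(`le_two_mul_sqrt_mul`).
-/

/-! ### Norms of states and the distinguishing advantage between states -/

section States

variable {w k n m il ol : ℕ}

/-- The squared norm of a state vector. -/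
noncomputable def sqNorm (ψ : QState w k n m il ol) : ℝ := ∑ r, ‖ψ r‖ ^ 2

theorem sqNorm_nonneg (ψ : QState w k n m il ol) : 0 ≤ sqNorm ψ :=
  Finset.sum_nonneg fun _ _ => by positivity

theorem norm_add_sq_le_two_mul (a b : ℂ) : ‖a + b‖ ^ 2 ≤ 2 * ‖a‖ ^ 2 + 2 * ‖b‖ ^ 2 := by
  have h := norm_add_le a b
  nlinarith [norm_nonneg (a + b), norm_nonneg a, norm_nonneg b, sq_nonneg (‖a‖ - ‖b‖)]

theorem norm_sub_sq_le_two_mul (a b : ℂ) : ‖a - b‖ ^ 2 ≤ 2 * ‖a‖ ^ 2 + 2 * ‖b‖ ^ 2 := by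
  simpa [sub_eq_add_neg] using norm_add_sq_le_two_mul a (-b)

theorem sqNorm_add_le (ψ φ : QState w k n m il ol) :
    sqNorm (ψ + φ) ≤ 2 * sqNorm ψ + 2 * sqNorm φ := by
  simp only [sqNorm, Finset.mul_sum, ← Finset.sum_add_distrib]
  exact Finset.sum_le_sum fun r _ => norm_add_sq_le_two_mul _ _

theorem sqNorm_initState : sqNorm (initState : QState w k n m il ol) = 1 := by
  simp only [sqNorm, initState]
  rw [Finset.sum_eq_single 0] <;> simp +contextual

theorem sqNorm_applyPerm (P : Equiv.Perm (Reg w k n m il ol)) (ψ : QState w k n m il ol) :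
    sqNorm (applyPerm P ψ) = sqNorm ψ :=
  Equiv.sum_comp P.symm fun r => ‖ψ r‖ ^ 2

theorem sum_sqNorm_projectEvInput (ψ : QState w k n m il ol) :
    ∑ x, sqNorm (projectEvInput x ψ) = sqNorm ψ := by
  simp only [sqNorm]
  rw [Finset.sum_comm]
  refine Finset.sum_congr rfl fun r _ => ?_
  rw [Finset.sum_eq_single r.2.2.1]
  · simp [projectEvInput]
  · intro x _ hx
    simp [projectEvInput, Ne.symm hx]
  · simp

theorem sqNorm_eq_dotProduct (ψ : QState w k n m il ol) : ((sqNorm ψ : ℝ) : ℂ) = star ψ ⬝ᵥ ψ := by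
  simp only [sqNorm, dotProduct, Complex.ofReal_sum, Pi.star_apply]
  refine Finset.sum_congr rfl fun r _ => ?_
  rw [RCLike.star_def, Complex.conj_mul']
  push_cast
  rfl

theorem sum_sqNorm_mulVec {r : ℕ} (V : Fin r → Matrix (Reg w k n m il ol) (Reg w k n m il ol) ℂ)
    (hV : ∑ i, (V i)ᴴ * V i = 1) (ψ : QState w k n m il ol) :
    ∑ i, sqNorm (V i *ᵥ ψ) = sqNorm ψ := by
  apply Complex.ofReal_injective
  rw [Complex.ofReal_sum]
  calc ∑ i, ((sqNorm (V i *ᵥ ψ) : ℝ) : ℂ) = ∑ i, star ψ ⬝ᵥ (((V i)ᴴ * V i) *ᵥ ψ) := by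
        refine Finset.sum_congr rfl fun i _ => ?_
        rw [sqNorm_eq_dotProduct, Matrix.star_mulVec, ← Matrix.dotProduct_mulVec,
          Matrix.mulVec_mulVec]
    _ = star ψ ⬝ᵥ ((∑ i, (V i)ᴴ * V i) *ᵥ ψ) := by
        rw [Matrix.sum_mulVec, dotProduct_sum]
    _ = _ := by rw [hV, Matrix.one_mulVec, sqNorm_eq_dotProduct]

theorem applyPerm_sub (P : Equiv.Perm (Reg w k n m il ol)) (ψ φ : QState w k n m il ol) :
    applyPerm P (ψ - φ) = applyPerm P ψ - applyPerm P φ := rfl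

theorem applyPerm_add (P : Equiv.Perm (Reg w k n m il ol)) (ψ φ : QState w k n m il ol) :
    applyPerm P (ψ + φ) = applyPerm P ψ + applyPerm P φ := rfl

theorem projectEvInput_sub (x : Bits il) (ψ φ : QState w k n m il ol) :
    projectEvInput x (ψ - φ) = projectEvInput x ψ - projectEvInput x φ := by
  funext r
  simp only [projectEvInput, Pi.sub_apply]
  split_ifs <;> simp

theorem projectEvInput_add (x : Bits il) (ψ φ : QState w k n m il ol) :
    projectEvInput x (ψ + φ) = projectEvInput x ψ + projectEvInput x φ := by
  funext r
  simp only [projectEvInput, Pi.add_apply]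
  split_ifs <;> simp

theorem norm_sq_sub_norm_sq_le (a b : ℂ) {c : ℝ} (hc : 0 < c) :
    ‖a‖ ^ 2 - ‖b‖ ^ 2 ≤ (c * ‖a - b‖ ^ 2 + c⁻¹ * ‖a + b‖ ^ 2) / 2 := by
  have h1 : ‖a‖ ^ 2 - ‖b‖ ^ 2 ≤ ‖a - b‖ * ‖a + b‖ := by
    rw [← norm_mul, ← norm_pow, ← norm_pow]
    calc ‖a ^ 2‖ - ‖b ^ 2‖ ≤ ‖a ^ 2 - b ^ 2‖ := norm_sub_norm_le _ _
      _ = _ := by congr 1; ring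
  have h2 : c * (c⁻¹ * ‖a + b‖) ^ 2 = c⁻¹ * ‖a + b‖ ^ 2 := by field_simp
  have h3 : c * (‖a - b‖ * (c⁻¹ * ‖a + b‖)) = ‖a - b‖ * ‖a + b‖ := by field_simp
  nlinarith [mul_nonneg hc.le (sq_nonneg (‖a - b‖ - c⁻¹ * ‖a + b‖))]

/-- The acceptance probability is a quadratic form `⟨ψ, E ψ⟩` with `0 ≤ E ≤ 1`. Subtracting half of
the squared norm replaces `E` by `E - 1/2`, of norm at most `1/2`, which gives this bound after an
inequality of arithmetic and geometric means with weight `c`. In this form both sides are additive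
over measurement outcomes, so that induction on the adversary applies directly. -/
theorem acceptProb_sub_le_aux (H : Fcs k n m) (f : Bits il → Bits ol) {c : ℝ} (hc : 0 < c)
    (A : Adversary w k n m il ol) (ψ φ : QState w k n m il ol) :
    acceptProb H f A ψ - acceptProb H f A φ ≤
      (sqNorm ψ - sqNorm φ) / 2 + (c * sqNorm (ψ - φ) + c⁻¹ * sqNorm (ψ + φ)) / 4 := by
  induction A generalizing ψ φ with
  | halt =>
    simp only [acceptProb, sqNorm, ← Finset.sum_sub_distrib, Finset.mul_sum,
      ← Finset.sum_add_distrib, Finset.sum_div]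
    refine Finset.sum_le_sum fun r _ => ?_
    have h1 := norm_sq_sub_norm_sq_le (ψ r) (φ r) hc
    have h2 := norm_sq_sub_norm_sq_le (φ r) (ψ r) hc
    rw [norm_sub_rev, add_comm (φ r)] at h2
    simp only [Pi.sub_apply, Pi.add_apply]
    split_ifs <;> linarith
  | act V hV next ih =>
    simp only [acceptProb]
    rw [← sum_sqNorm_mulVec V hV ψ, ← sum_sqNorm_mulVec V hV φ, ← sum_sqNorm_mulVec V hV (ψ - φ),
      ← sum_sqNorm_mulVec V hV (ψ + φ)]
    simp only [← Finset.sum_sub_distrib, Finset.mul_sum, ← Finset.sum_add_distrib, Finset.sum_div,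
      Matrix.mulVec_sub, Matrix.mulVec_add]
    exact Finset.sum_le_sum fun i _ => ih i _ _
  | roQuery next ih =>
    simp only [acceptProb]
    refine (ih _ _).trans_eq ?_
    rw [← applyPerm_sub, ← applyPerm_add]
    simp only [sqNorm_applyPerm]
  | evQuery next ih =>
    simp only [acceptProb]
    rw [← sum_sqNorm_projectEvInput ψ, ← sum_sqNorm_projectEvInput φ,
      ← sum_sqNorm_projectEvInput (ψ - φ), ← sum_sqNorm_projectEvInput (ψ + φ)]
    simp only [← Finset.sum_sub_distrib, Finset.mul_sum, ← Finset.sum_add_distrib, Finset.sum_div]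
    refine Finset.sum_le_sum fun x _ => (ih _ _).trans_eq ?_
    rw [← applyPerm_sub, ← applyPerm_add]
    simp only [sqNorm_applyPerm, projectEvInput_sub, projectEvInput_add]

theorem acceptProb_sub_le (H : Fcs k n m) (f : Bits il → Bits ol) {c : ℝ} (hc : 0 < c)
    (A : Adversary w k n m il ol) (ψ φ : QState w k n m il ol) :
    acceptProb H f A ψ - acceptProb H f A φ ≤
      (sqNorm ψ - sqNorm φ) / 2 + c / 4 * sqNorm (ψ - φ) + c⁻¹ / 2 * (sqNorm ψ + sqNorm φ) := by
  have h1 := acceptProb_sub_le_aux H f hc A ψ φ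
  have h2 := mul_le_mul_of_nonneg_left (sqNorm_add_le ψ φ) (inv_nonneg.2 hc.le)
  linarith

/-- Two families of states of the same total weight are told apart with advantage at most
`W / c + c / 4 * Δ` for every `c > 0`, where `Δ` is their total squared distance; at the optimal `c`
this is `√(W * Δ)`. -/
theorem sum_acceptProb_sub_le {ι : Type*} [Fintype ι] (H : ι → Fcs k n m)
    (f : ι → Bits il → Bits ol) {c : ℝ} (hc : 0 < c) (A : Adversary w k n m il ol)
    (ψ φ : ι → QState w k n m il ol) {W Δ : ℝ} (hψ : ∑ i, sqNorm (ψ i) = W)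
    (hφ : ∑ i, sqNorm (φ i) = W) (hΔ : ∑ i, sqNorm (ψ i - φ i) ≤ Δ) :
    ∑ i, acceptProb (H i) (f i) A (ψ i) - ∑ i, acceptProb (H i) (f i) A (φ i) ≤
      c / 4 * Δ + W / c := by
  rw [← Finset.sum_sub_distrib]
  refine (Finset.sum_le_sum fun i _ => acceptProb_sub_le (H i) (f i) hc A (ψ i) (φ i)).trans ?_
  rw [Finset.sum_add_distrib, Finset.sum_add_distrib, ← Finset.sum_div, ← Finset.mul_sum,
    ← Finset.mul_sum, Finset.sum_sub_distrib, Finset.sum_add_distrib, hψ, hφ]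
  have := mul_le_mul_of_nonneg_left hΔ (by positivity : 0 ≤ c / 4)
  rw [div_eq_mul_inv W c]
  linarith

end States

/-! ### Reprogramming the random oracle -/

section Reprogramming

variable {k n m : ℕ}

/-- The randomness of the ideal game: a random oracle and the function behind `Ev`. -/
abbrev World (k n m : ℕ) : Type := Fcs k n m × (Bits n → Bits m)

namespace World

/-- Change the value of the random oracle at `z` to `y`. -/
def setRo (p : World k n m) (z : Bits k × Bits n) (y : Bits m) : World k n m :=
  (fun a b => if (a, b) = z then y else p.1 a b, p.2)

/-- Change the value of the function behind `Ev` at `x` to `y`. -/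
def setEv (p : World k n m) (x : Bits n) (y : Bits m) : World k n m :=
  (p.1, fun a => if a = x then y else p.2 a)

/-- Exchange the value of the random oracle at `z` with the value of `Ev` at `x`. -/
def exchange (z : Bits k × Bits n) (x : Bits n) (p : World k n m) : World k n m :=
  (p.setRo z (p.2 x)).setEv x (p.1 z.1 z.2)

theorem exchange_involutive (z : Bits k × Bits n) (x : Bits n) :
    Function.Involutive (exchange z x : World k n m → World k n m) := by
  rintro ⟨H, F⟩
  ext1
  · funext a b
    by_cases h : (a, b) = z
    · subst h; simp [exchange, setRo, setEv]
    · simp [exchange, setRo, setEv, h]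
  · funext a
    by_cases h : a = x
    · subst h; simp [exchange, setRo, setEv]
    · simp [exchange, setRo, setEv, h]

theorem sum_exchange (z : Bits k × Bits n) (x : Bits n) (g : World k n m → ℝ) :
    ∑ p, g (exchange z x p) = ∑ p, g p :=
  Equiv.sum_comp (exchange_involutive z x).toPerm g

theorem sum_setRo (z : Bits k × Bits n) (g : World k n m → ℝ) :
    ∑ p, ∑ y, g (setRo p z y) = Fintype.card (Bits m) * ∑ p, g p := by
  have hinv : Function.Involutive
      (fun t : World k n m × Bits m => (t.1.setRo z t.2, t.1.1 z.1 z.2)) := by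
    rintro ⟨⟨H, F⟩, y⟩
    refine Prod.ext (Prod.ext ?_ rfl) (by simp [setRo])
    funext a b
    by_cases h : (a, b) = z
    · subst h; simp [setRo]
    · simp [setRo, h]
  rw [← Fintype.sum_prod_type' (fun p y => g (setRo p z y)),
    ← Equiv.sum_comp hinv.toPerm, Fintype.sum_prod_type, Finset.mul_sum]
  refine Finset.sum_congr rfl fun p _ => ?_
  rw [Finset.sum_congr rfl (g := fun _ => g p)]
  · simp
  · intro y _
    have := congrArg Prod.fst (hinv (p, y))
    exact congrArg g this

/-- A value of `Ev` on which nothing else depends may be replaced by a fresh one. -/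
theorem sum_fresh_ev (x : Bits n) (g : World k n m → Bits m → ℝ)
    (hg : ∀ p y u, g (p.setEv x u) y = g p y) :
    ∑ p, ∑ y, g p y = Fintype.card (Bits m) * ∑ p, g p (p.2 x) := by
  have hinv : Function.Involutive
      (fun t : World k n m × Bits m => (t.1.setEv x t.2, t.1.2 x)) := by
    rintro ⟨⟨H, F⟩, y⟩
    refine Prod.ext (Prod.ext rfl ?_) (by simp [setEv])
    funext a
    by_cases h : a = x
    · subst h; simp [setEv]
    · simp [setEv, h]
  rw [← Fintype.sum_prod_type' g, ← Equiv.sum_comp hinv.toPerm, Fintype.sum_prod_type,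
    Finset.mul_sum]
  refine Finset.sum_congr rfl fun p _ => ?_
  simp [hg]

end World

/-- The point at which `FFX` with key `K` queries the random oracle on input `x`. -/
def keyPoint (K : Bits (k + n)) (x : Bits n) : Bits k × Bits n :=
  (fun i => K (Fin.castAdd n i), x + fun j => K (Fin.natAdd k j))

theorem FFX_apply (H : Fcs k n m) (K : Bits (k + n)) (x : Bits n) :
    FFX k n m H K x = H (keyPoint K x).1 (keyPoint K x).2 := rfl

theorem keyPoint_snd_add (K : Bits (k + n)) (x : Bits n) :
    (keyPoint K x).2 + (fun j => K (Fin.natAdd k j)) = x := by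
  funext i
  simp [keyPoint, add_assoc, CharTwo.add_self_eq_zero]

theorem keyPoint_injective (K : Bits (k + n)) : Function.Injective (keyPoint (k := k) K) :=
  fun _ _ h => add_right_cancel (congrArg Prod.snd h)

theorem sum_keyPoint (x : Bits n) (g : Bits k × Bits n → ℝ) :
    ∑ K, g (keyPoint K x) = ∑ z, g z := by
  refine Fintype.sum_bijective (fun K => keyPoint K x) ?_ _ _ fun _ => rfl
  rw [Fintype.bijective_iff_injective_and_card]
  refine ⟨fun K L h => ?_, by simp [pow_add, ZMod.card]⟩
  funext i
  refine Fin.addCases (fun i => ?_) (fun j => ?_) i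
  · exact congrFun (congrArg Prod.fst h) i
  · exact congrFun (add_left_cancel (congrArg Prod.snd h)) j

/-- The random oracle of `p`, reprogrammed so that `FFX` with key `K` agrees on `S` with the
function behind `Ev`. -/
def reprogram (K : Bits (k + n)) (S : Finset (Bits n)) (p : World k n m) : Fcs k n m :=
  fun a b => if ∃ x ∈ S, keyPoint K x = (a, b) then p.2 (b + fun j => K (Fin.natAdd k j))
    else p.1 a b

theorem reprogram_empty (K : Bits (k + n)) (p : World k n m) : reprogram K ∅ p = p.1 := by
  funext a b
  simp [reprogram]

theorem FFX_reprogram {K : Bits (k + n)} {S : Finset (Bits n)} (p : World k n m) {x : Bits n}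
    (hx : x ∈ S) : FFX k n m (reprogram K S p) K x = p.2 x := by
  rw [FFX_apply, reprogram, if_pos ⟨x, hx, rfl⟩]
  rw [keyPoint_snd_add]

/-- At a fresh input, answering with the reprogrammed oracle amounts, after an exchange of two
uniform values, to reprogramming at one more point. -/
theorem reprogram_exchange {K : Bits (k + n)} {S : Finset (Bits n)} {x : Bits n} (hx : x ∉ S)
    (p : World k n m) :
    reprogram K S (World.exchange (keyPoint K x) x p) = reprogram K (insert x S) p := by
  funext a b
  have key : ∀ u, keyPoint K u = (a, b) → b + (fun j => K (Fin.natAdd k j)) = u := by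
    intro u hu
    rw [← keyPoint_snd_add K u, hu]
  by_cases h : ∃ u ∈ S, keyPoint K u = (a, b)
  · obtain ⟨u, hu, huz⟩ := h
    have hux : u ≠ x := fun h => hx (h ▸ hu)
    rw [reprogram, if_pos ⟨u, hu, huz⟩, reprogram, if_pos ⟨u, Finset.mem_insert_of_mem hu, huz⟩,
      key u huz]
    simp [World.exchange, World.setEv, World.setRo, hux]
  · by_cases hz : keyPoint K x = (a, b)
    · rw [reprogram, if_neg h, reprogram, if_pos ⟨x, Finset.mem_insert_self _ _, hz⟩, key x hz]
      simp [World.exchange, World.setEv, World.setRo, hz]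
    · rw [reprogram, if_neg h, reprogram, if_neg]
      · simp [World.exchange, World.setEv, World.setRo, Ne.symm hz]
      · rintro ⟨u, hu, huz⟩
        rcases Finset.mem_insert.1 hu with rfl | hu
        · exact hz huz
        · exact h ⟨u, hu, huz⟩

/-- Over a uniform key, each point of the random oracle is reprogrammed with probability
`#S / 2 ^ (k + n)`. -/
theorem sum_reprogrammed (S : Finset (Bits n)) (z : Bits k × Bits n) :
    ∑ K : Bits (k + n), (if ∃ x ∈ S, keyPoint K x = z then (1 : ℝ) else 0) = S.card := by
  calc _ = ∑ K : Bits (k + n), ∑ x ∈ S, if keyPoint K x = z then (1 : ℝ) else 0 := by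
        refine Finset.sum_congr rfl fun K _ => ?_
        split_ifs with h
        · obtain ⟨x, hx, rfl⟩ := h
          simp [(keyPoint_injective K).eq_iff, hx]
        · exact (Finset.sum_eq_zero fun x hx => if_neg fun hxz => h ⟨x, hx, hxz⟩).symm
    _ = ∑ x ∈ S, 1 := by
        rw [Finset.sum_comm]
        refine Finset.sum_congr rfl fun x _ => ?_
        rw [sum_keyPoint x fun u => if u = z then (1 : ℝ) else 0]
        simp
    _ = S.card := by simp

end Reprogramming

/-! ### Single queries -/

section Queries

variable {w k n m il ol : ℕ}

/-- The content of the input register of the random oracle. -/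
def roInput (r : Reg w k n m il ol) : Bits k × Bits n := (r.2.1.1, r.2.1.2.1)

theorem roPerm_symm_congr {H H' : Fcs k n m} {r : Reg w k n m il ol}
    (h : H (roInput r).1 (roInput r).2 = H' (roInput r).1 (roInput r).2) :
    (roPerm H).symm r = (roPerm H').symm r := by
  obtain ⟨W, ⟨a, b, c⟩, e⟩ := r
  simp only [roInput] at h
  simp [roPerm, Equiv.symm, h]

/-- On a measured query, only the value of the construction oracle at the outcome matters. -/
theorem applyPerm_evPerm_congr {f g : Bits il → Bits ol} {x : Bits il} (h : f x = g x)
    (ψ : QState w k n m il ol) :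
    applyPerm (evPerm f) (projectEvInput x ψ) = applyPerm (evPerm g) (projectEvInput x ψ) := by
  funext ⟨W, R, a, b⟩
  simp only [applyPerm, evPerm, Equiv.symm, Equiv.coe_fn_mk, projectEvInput]
  by_cases hx : a = x
  · subst hx; simp [h]
  · simp [hx]

/-- Queries to two oracles that agree outside of a set of inputs differ at most in the part of the
state whose input lies in this set. -/
theorem sqNorm_roQuery_sub_le (P : Bits k × Bits n → Prop) [DecidablePred P] {H H' : Fcs k n m}
    (h : ∀ z, ¬ P z → H z.1 z.2 = H' z.1 z.2) (ψ : QState w k n m il ol) :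
    sqNorm (applyPerm (roPerm H) ψ - applyPerm (roPerm H') ψ) ≤
      4 * ∑ r, if P (roInput r) then ‖ψ r‖ ^ 2 else 0 := by
  have hperm : ∀ G : Fcs k n m,
      ∑ r, (if P (roInput r) then ‖applyPerm (roPerm G) ψ r‖ ^ 2 else 0) =
        ∑ r, if P (roInput r) then ‖ψ r‖ ^ 2 else 0 := fun G =>
    Equiv.sum_comp (roPerm G).symm fun r => if P (roInput r) then ‖ψ r‖ ^ 2 else 0
  calc _ ≤ ∑ r, ((if P (roInput r) then 2 * ‖applyPerm (roPerm H) ψ r‖ ^ 2 else 0) +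
        if P (roInput r) then 2 * ‖applyPerm (roPerm H') ψ r‖ ^ 2 else 0) := by
        refine Finset.sum_le_sum fun r _ => ?_
        split_ifs with hr
        · exact norm_sub_sq_le_two_mul _ _
        · simp [applyPerm, roPerm_symm_congr (h _ hr)]
    _ = 2 * ∑ r, (if P (roInput r) then ‖applyPerm (roPerm H) ψ r‖ ^ 2 else 0) +
        2 * ∑ r, (if P (roInput r) then ‖applyPerm (roPerm H') ψ r‖ ^ 2 else 0) := by
        simp [Finset.sum_add_distrib, Finset.mul_sum, mul_ite]
    _ = _ := by rw [hperm, hperm]; ring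

end Queries

/-! ### The influence of the random oracle on the state -/

section Influence

variable {w k n m : ℕ}

/-- States of an adversary against `FFX`, one for each choice of the randomness. -/
abbrev Family (w k n m : ℕ) : Type := World k n m → QState w k n m n m

namespace Family

/-- The sum of the squared norms of the states of a family. -/
noncomputable def weight (Ψ : Family w k n m) : ℝ := ∑ p, sqNorm (Ψ p)

/-- The total influence of the values of the random oracle on a family of states: the squared change
of the state when the value at `z` is resampled, averaged over the new value and summed over all
points `z` and, like `weight`, over all `p`. -/
noncomputable def influence (Ψ : Family w k n m) : ℝ :=
  (∑ z, ∑ p, ∑ y, sqNorm (Ψ p - Ψ (World.setRo p z y))) / Fintype.card (Bits m)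

/-- The family after a query to the random oracle. -/
def roQuery (Ψ : Family w k n m) : Family w k n m := fun p => applyPerm (roPerm p.1) (Ψ p)

/-- The family after a query to `Ev` whose measured input is `x`. -/
def evQuery (x : Bits n) (Ψ : Family w k n m) : Family w k n m :=
  fun p => applyPerm (evPerm p.2) (projectEvInput x (Ψ p))

theorem weight_nonneg (Ψ : Family w k n m) : 0 ≤ Ψ.weight :=
  Finset.sum_nonneg fun _ _ => sqNorm_nonneg _

theorem influence_nonneg (Ψ : Family w k n m) : 0 ≤ Ψ.influence :=
  div_nonneg (Finset.sum_nonneg fun _ _ => Finset.sum_nonneg fun _ _ => Finset.sum_nonneg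
    fun _ _ => sqNorm_nonneg _) (Nat.cast_nonneg _)

theorem weight_roQuery (Ψ : Family w k n m) : Ψ.roQuery.weight = Ψ.weight := by
  simp only [weight, roQuery, sqNorm_applyPerm]

theorem sum_weight_mulVec {r : ℕ} (V : Fin r → Matrix (Reg w k n m n m) (Reg w k n m n m) ℂ)
    (hV : ∑ i, (V i)ᴴ * V i = 1) (Ψ : Family w k n m) :
    ∑ i, weight (fun p => V i *ᵥ Ψ p) = Ψ.weight := by
  simp only [weight]
  rw [Finset.sum_comm]
  simp only [sum_sqNorm_mulVec V hV]

theorem sum_weight_evQuery (Ψ : Family w k n m) : ∑ x, (Ψ.evQuery x).weight = Ψ.weight := by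
  simp only [weight, evQuery, sqNorm_applyPerm]
  rw [Finset.sum_comm]
  simp only [sum_sqNorm_projectEvInput]

theorem sum_sum_comm_triple {ι α β γ : Type*} [Fintype ι] [Fintype α] [Fintype β] [Fintype γ]
    (g : ι → α → β → γ → ℝ) :
    ∑ i, ∑ a, ∑ b, ∑ c, g i a b c = ∑ a, ∑ b, ∑ c, ∑ i, g i a b c := by
  rw [Finset.sum_comm]
  refine Finset.sum_congr rfl fun a _ => ?_
  rw [Finset.sum_comm]
  refine Finset.sum_congr rfl fun b _ => ?_
  rw [Finset.sum_comm]

theorem sum_influence_mulVec {r : ℕ} (V : Fin r → Matrix (Reg w k n m n m) (Reg w k n m n m) ℂ)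
    (hV : ∑ i, (V i)ᴴ * V i = 1) (Ψ : Family w k n m) :
    ∑ i, influence (fun p => V i *ᵥ Ψ p) = Ψ.influence := by
  simp only [influence]
  rw [← Finset.sum_div, sum_sum_comm_triple]
  simp only [← Matrix.mulVec_sub, sum_sqNorm_mulVec V hV]

theorem influence_evQuery (x : Bits n) (Ψ : Family w k n m) :
    (Ψ.evQuery x).influence = influence fun p => projectEvInput x (Ψ p) := by
  have h : ∀ (p : World k n m) z y, sqNorm (Ψ.evQuery x p - Ψ.evQuery x (p.setRo z y)) =
      sqNorm (projectEvInput x (Ψ p) - projectEvInput x (Ψ (p.setRo z y))) := by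
    intro p z y
    change sqNorm (applyPerm (evPerm p.2) _ - applyPerm (evPerm p.2) _) = _
    rw [← applyPerm_sub, sqNorm_applyPerm]
  simp only [influence, h]

theorem sum_influence_evQuery (Ψ : Family w k n m) :
    ∑ x, (Ψ.evQuery x).influence = Ψ.influence := by
  simp only [influence_evQuery]
  simp only [influence]
  rw [← Finset.sum_div, sum_sum_comm_triple]
  simp only [← projectEvInput_sub, sum_sqNorm_projectEvInput]

theorem sum_sum_roInput (Ψ : Family w k n m) :
    ∑ z, ∑ p, ∑ r, (if roInput r = z then ‖Ψ p r‖ ^ 2 else 0) = Ψ.weight := by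
  rw [Finset.sum_comm]
  refine Finset.sum_congr rfl fun p _ => ?_
  rw [Finset.sum_comm]
  exact Finset.sum_congr rfl fun r _ => by simp

/-- A query increases the total influence by at most four times the weight: the part of the state
with input `z` can only become dependent on the value of the oracle at `z`. -/
theorem influence_roQuery_le (Ψ : Family w k n m) :
    Ψ.roQuery.influence ≤ Ψ.influence + 4 * Ψ.weight := by
  have hM : (0 : ℝ) < Fintype.card (Bits m) := by exact_mod_cast Fintype.card_pos
  have point : ∀ z (p : World k n m) y, sqNorm (Ψ.roQuery p - Ψ.roQuery (p.setRo z y)) ≤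
      sqNorm (Ψ p - Ψ (p.setRo z y)) +
        (2 * (∑ r, if roInput r = z then ‖Ψ.roQuery p r‖ ^ 2 else 0) +
        2 * ∑ r, if roInput r = z then ‖Ψ.roQuery (p.setRo z y) r‖ ^ 2 else 0) := by
    intro z p y
    rw [← sqNorm_applyPerm (roPerm p.1) (Ψ p - _)]
    simp only [sqNorm, Finset.mul_sum, ← Finset.sum_add_distrib]
    refine Finset.sum_le_sum fun r _ => ?_
    by_cases h : roInput r = z
    · simp only [if_pos h]
      exact (norm_sub_sq_le_two_mul _ _).trans (le_add_of_nonneg_left (by positivity))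
    · have hp : (roPerm (p.setRo z y).1).symm r = (roPerm p.1).symm r :=
        roPerm_symm_congr (by simp [World.setRo, h])
      simp [h, roQuery, applyPerm, hp]
  have key : ∀ z, ∑ p, ∑ y, sqNorm (Ψ.roQuery p - Ψ.roQuery (World.setRo p z y)) ≤
      ∑ p, ∑ y, sqNorm (Ψ p - Ψ (World.setRo p z y)) + 4 * Fintype.card (Bits m) *
        ∑ p, ∑ r, if roInput r = z then ‖Ψ.roQuery p r‖ ^ 2 else 0 := by
    intro z
    refine (Finset.sum_le_sum fun p _ => Finset.sum_le_sum fun y _ => point z p y).trans_eq ?_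
    simp only [Finset.sum_add_distrib, ← Finset.mul_sum]
    rw [World.sum_setRo z fun p => ∑ r, if roInput r = z then ‖Ψ.roQuery p r‖ ^ 2 else 0]
    simp only [Finset.sum_const, Finset.card_univ, nsmul_eq_mul, ← Finset.mul_sum]
    ring
  have total := Finset.sum_le_sum fun z (_ : z ∈ Finset.univ) => key z
  rw [Finset.sum_add_distrib, ← Finset.mul_sum, sum_sum_roInput, weight_roQuery] at total
  rw [influence, influence, div_le_iff₀ hM, add_mul, div_mul_cancel₀ _ hM.ne']
  linarith

/-- If the value of `Ev` at `x` is still unused, then programming it into the random oracle at the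
point that a uniform key assigns to `x` changes the states by the total influence. -/
theorem sum_sqNorm_exchange (x : Bits n) (Ψ : Family w k n m)
    (hΨ : ∀ p y, Ψ (World.setEv p x y) = Ψ p) :
    ∑ K : Bits (k + n), ∑ p, sqNorm (Ψ (World.exchange (keyPoint K x) x p) - Ψ p) =
      Ψ.influence := by
  have hM : (Fintype.card (Bits m) : ℝ) ≠ 0 := by exact_mod_cast Fintype.card_ne_zero
  rw [sum_keyPoint x fun z => ∑ p, sqNorm (Ψ (World.exchange z x p) - Ψ p), influence,
    eq_div_iff hM, Finset.sum_mul]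
  refine Finset.sum_congr rfl fun z _ => ?_
  rw [World.sum_fresh_ev x fun p y => sqNorm (Ψ p - Ψ (p.setRo z y)), mul_comm]
  · congr 1
    refine Finset.sum_congr rfl fun p _ => ?_
    simp only [World.exchange, hΨ, sqNorm]
    exact Finset.sum_congr rfl fun r _ => by simp only [Pi.sub_apply, norm_sub_rev]
  · intro p y u
    change sqNorm (Ψ (p.setEv x u) - Ψ ((p.setRo z y).setEv x u)) = _
    rw [hΨ, hΨ]

end Family

end Influence

/-! ### The hybrid argument -/

section Hybrid

variable {w k n m : ℕ}

/-- The sum over all keys and all `p` of the acceptance probability in the hybrid game that starts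
in the state `Ψ p` and runs the real game, with the random oracle reprogrammed on `S`. -/
noncomputable def hybridSum (S : Finset (Bits n)) (A : Adversary w k n m n m)
    (Ψ : Family w k n m) : ℝ :=
  ∑ K : Bits (k + n), ∑ p, acceptProb (reprogram K S p) (FFX k n m (reprogram K S p) K) A (Ψ p)

/-- The sum over all `p` of the acceptance probability in the ideal game started in `Ψ p`. -/
noncomputable def idealSum (A : Adversary w k n m n m) (Ψ : Family w k n m) : ℝ :=
  ∑ p, acceptProb p.1 p.2 A (Ψ p)

/-- Answering one query with the original instead of the reprogrammed oracle. The key is still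
independent of the state, so a query hits a reprogrammed point with mean weight `#S / 2 ^ (k + n)`,
whatever the state. -/
theorem hybridSum_roQuery_le {c : ℝ} (hc : 0 < c) (S : Finset (Bits n))
    (A : Adversary w k n m n m) (Ψ : Family w k n m) :
    hybridSum S (.roQuery A) Ψ ≤
      hybridSum S A Ψ.roQuery + (c * S.card + 2 ^ (k + n) / c) * Ψ.weight := by
  have h := sum_acceptProb_sub_le (ι := Bits (k + n) × World k n m)
    (fun i => reprogram i.1 S i.2) (fun i => FFX k n m (reprogram i.1 S i.2) i.1) hc A
    (fun i => applyPerm (roPerm (reprogram i.1 S i.2)) (Ψ i.2))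
    (fun i => Ψ.roQuery i.2) (W := 2 ^ (k + n) * Ψ.weight) (Δ := 4 * (S.card * Ψ.weight))
    (by simp [Fintype.sum_prod_type, sqNorm_applyPerm, Family.weight, ZMod.card])
    (by simp [Fintype.sum_prod_type, sqNorm_applyPerm, Family.weight, ZMod.card, Family.roQuery])
    ?_
  · simp only [Fintype.sum_prod_type (α₁ := Bits (k + n))] at h
    simp only [hybridSum, acceptProb]
    have e : c / 4 * (4 * (S.card * Ψ.weight)) + 2 ^ (k + n) * Ψ.weight / c =
      (c * S.card + 2 ^ (k + n) / c) * Ψ.weight := by ring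
    linarith
  · classical
    rw [Fintype.sum_prod_type]
    calc _ ≤ ∑ K : Bits (k + n), ∑ p, 4 * ∑ r,
          if ∃ x ∈ S, keyPoint K x = roInput r then ‖Ψ p r‖ ^ 2 else 0 := by
          refine Finset.sum_le_sum fun K _ => Finset.sum_le_sum fun p _ => ?_
          refine sqNorm_roQuery_sub_le (fun z => ∃ x ∈ S, keyPoint K x = z) (fun z hz => ?_) _
          exact if_neg hz
      _ = 4 * ∑ p, ∑ r, (∑ K : Bits (k + n),
          if ∃ x ∈ S, keyPoint K x = roInput r then (1 : ℝ) else 0) * ‖Ψ p r‖ ^ 2 := by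
          simp only [← Finset.mul_sum, Finset.sum_mul, ite_mul, one_mul, zero_mul]
          rw [Finset.sum_comm]
          congr 1
          exact Finset.sum_congr rfl fun p _ => Finset.sum_comm
      _ = _ := by
          simp only [sum_reprogrammed, Family.weight, sqNorm, Finset.mul_sum]

theorem hybridSum_evQuery (S : Finset (Bits n)) (A : Adversary w k n m n m)
    (Ψ : Family w k n m) :
    hybridSum S (.evQuery A) Ψ = ∑ x, ∑ K : Bits (k + n), ∑ p,
      acceptProb (reprogram K S p) (FFX k n m (reprogram K S p) K) A
        (applyPerm (evPerm (FFX k n m (reprogram K S p) K)) (projectEvInput x (Ψ p))) := by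
  simp only [hybridSum, acceptProb]
  rw [Finset.sum_comm (s := (Finset.univ : Finset (Bits n)))]
  exact Finset.sum_congr rfl fun K _ => Finset.sum_comm

/-- One classical query to `Ev`, with measured input `x`. If `x` was queried before then nothing
changes. Otherwise one more point is reprogrammed; in superposition over the random oracle this
exchanges two uniform values, which the state notices only through its influence at that point. -/
theorem hybridSum_evQuery_branch_le {d : ℝ} (hd : 0 < d) (S : Finset (Bits n))
    (A : Adversary w k n m n m) (Ψ : Family w k n m)
    (hΨ : ∀ x ∉ S, ∀ p y, Ψ (World.setEv p x y) = Ψ p) (x : Bits n) :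
    ∑ K : Bits (k + n), ∑ p,
      acceptProb (reprogram K S p) (FFX k n m (reprogram K S p) K) A
        (applyPerm (evPerm (FFX k n m (reprogram K S p) K)) (projectEvInput x (Ψ p))) ≤
      hybridSum (insert x S) A (Ψ.evQuery x) +
        (d / 4 * (Ψ.evQuery x).influence + 2 ^ (k + n) / d * (Ψ.evQuery x).weight) := by
  have hI := (Ψ.evQuery x).influence_nonneg
  have hW := (Ψ.evQuery x).weight_nonneg
  by_cases hx : x ∈ S
  · refine le_add_of_le_of_nonneg (le_of_eq ?_) (by positivity)
    rw [Finset.insert_eq_self.2 hx, hybridSum]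
    refine Finset.sum_congr rfl fun K _ => Finset.sum_congr rfl fun p _ => ?_
    rw [applyPerm_evPerm_congr (FFX_reprogram p hx)]
    rfl
  · have hex : ∀ K : Bits (k + n), ∑ p,
        acceptProb (reprogram K S p) (FFX k n m (reprogram K S p) K) A
          (applyPerm (evPerm (FFX k n m (reprogram K S p) K)) (projectEvInput x (Ψ p))) =
        ∑ p, acceptProb (reprogram K (insert x S) p) (FFX k n m (reprogram K (insert x S) p) K) A
          (applyPerm (evPerm p.2)
            (projectEvInput x (Ψ (World.exchange (keyPoint K x) x p)))) := by
      intro K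
      rw [← World.sum_exchange (keyPoint K x) x]
      refine Finset.sum_congr rfl fun p _ => ?_
      rw [reprogram_exchange hx,
        applyPerm_evPerm_congr (FFX_reprogram p (Finset.mem_insert_self x S))]
    have h := sum_acceptProb_sub_le (ι := Bits (k + n) × World k n m)
      (fun i => reprogram i.1 (insert x S) i.2)
      (fun i => FFX k n m (reprogram i.1 (insert x S) i.2) i.1) hd A
      (fun i => applyPerm (evPerm i.2.2)
        (projectEvInput x (Ψ (World.exchange (keyPoint i.1 x) x i.2))))
      (fun i => Ψ.evQuery x i.2) (W := 2 ^ (k + n) * (Ψ.evQuery x).weight)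
      (Δ := (Ψ.evQuery x).influence) ?_ ?_ ?_
    · simp only [Fintype.sum_prod_type (α₁ := Bits (k + n))] at h
      simp only [hex, hybridSum]
      have e : 2 ^ (k + n) * (Ψ.evQuery x).weight / d =
        2 ^ (k + n) / d * (Ψ.evQuery x).weight := by ring
      linarith
    · rw [Fintype.sum_prod_type]
      simp only [sqNorm_applyPerm, World.sum_exchange _ x fun p => sqNorm (projectEvInput x (Ψ p))]
      simp [Family.weight, Family.evQuery, sqNorm_applyPerm, ZMod.card]
    · rw [Fintype.sum_prod_type]
      simp [Family.weight, ZMod.card]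
    · rw [Fintype.sum_prod_type, Family.influence_evQuery,
        ← Family.sum_sqNorm_exchange x (fun p => projectEvInput x (Ψ p))
          (fun p y => by rw [hΨ x hx])]
      simp only [Family.evQuery, ← applyPerm_sub, sqNorm_applyPerm, le_refl]

theorem Family.evQuery_setEv {S : Finset (Bits n)} {Ψ : Family w k n m}
    (hΨ : ∀ x ∉ S, ∀ p y, Ψ (World.setEv p x y) = Ψ p) (x : Bits n) :
    ∀ u ∉ insert x S, ∀ p y, Ψ.evQuery x (World.setEv p u y) = Ψ.evQuery x p := by
  intro u hu p y
  rw [Finset.mem_insert, not_or] at hu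
  rw [Family.evQuery, hΨ u hu.2]
  exact applyPerm_evPerm_congr (by simp [World.setEv, Ne.symm hu.1]) _

/-- The hybrid argument, by induction on the adversary. The potential on the right-hand side is
linear in the weight and in the influence of the family, hence additive over measurement outcomes:
each query to the random oracle pays for the reprogrammed points and may raise the influence, and
each query to `Ev` pays for the influence accumulated up to that query. -/
theorem hybridSum_sub_idealSum_le {c d : ℝ} (hc : 0 < c) (hd : 0 < d) (Q : ℕ)
    (A : Adversary w k n m n m) (s : List Oracle) (hA : A.QueriesInOrder s)
    (S : Finset (Bits n)) (hS : S.card + s.count Oracle.ev ≤ Q) (Ψ : Family w k n m)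
    (hΨ : ∀ x ∉ S, ∀ p y, Ψ (World.setEv p x y) = Ψ p) :
    hybridSum S A Ψ - 2 ^ (k + n) * idealSum A Ψ ≤
      s.count Oracle.ro * ((c * Q + 2 ^ (k + n) / c) * Ψ.weight) +
      s.count Oracle.ev * (d * (Ψ.influence / 4 + s.count Oracle.ro * Ψ.weight) +
        2 ^ (k + n) / d * Ψ.weight) := by
  induction A generalizing s S Ψ with
  | halt =>
    obtain rfl : s = [] := hA
    simp [hybridSum, idealSum, acceptProb, ZMod.card]
  | act V hV next ih =>
    have h := Finset.sum_le_sum fun i (_ : i ∈ Finset.univ) =>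
      ih i s (hA i) S hS (fun p => V i *ᵥ Ψ p) (fun x hx p y => by rw [hΨ x hx])
    have h1 : hybridSum S (.act V hV next) Ψ =
        ∑ i, hybridSum S (next i) fun p => V i *ᵥ Ψ p := by
      simp only [hybridSum, acceptProb]
      rw [Finset.sum_comm (s := (Finset.univ : Finset (Fin _)))]
      exact Finset.sum_congr rfl fun K _ => Finset.sum_comm
    have h2 : idealSum (.act V hV next) Ψ = ∑ i, idealSum (next i) fun p => V i *ᵥ Ψ p := by
      simp only [idealSum, acceptProb]
      exact Finset.sum_comm
    rw [h1, h2, Finset.mul_sum, ← Finset.sum_sub_distrib]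
    refine h.trans_eq ?_
    rw [← Family.sum_weight_mulVec V hV Ψ, ← Family.sum_influence_mulVec V hV Ψ]
    simp only [Finset.sum_add_distrib, ← Finset.mul_sum, ← Finset.sum_div]
  | roQuery next ih =>
    obtain ⟨t, rfl, ht⟩ := hA
    have hcount : (Oracle.ro :: t).count Oracle.ev = t.count Oracle.ev := by simp
    have hcount' : (Oracle.ro :: t).count Oracle.ro = t.count Oracle.ro + 1 := by simp
    rw [hcount] at hS ⊢
    rw [hcount']
    have h := ih t ht S hS Ψ.roQuery fun x hx p y => by
      simp only [Family.roQuery, hΨ x hx]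
      rfl
    rw [Family.weight_roQuery] at h
    have h1 := hybridSum_roQuery_le hc S next Ψ
    have h2 : idealSum (.roQuery next) Ψ = idealSum next Ψ.roQuery := rfl
    have h3 := Ψ.influence_roQuery_le
    have h4 : c * S.card * Ψ.weight ≤ c * Q * Ψ.weight := by
      have : (S.card : ℝ) ≤ Q := by exact_mod_cast (Nat.le_add_right _ _).trans hS
      have := Ψ.weight_nonneg
      gcongr
    have h5 : (t.count Oracle.ev : ℝ) * d * Ψ.roQuery.influence ≤
        t.count Oracle.ev * d * (Ψ.influence + 4 * Ψ.weight) := by gcongr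
    rw [h2]
    push_cast
    linarith
  | evQuery next ih =>
    obtain ⟨t, rfl, ht⟩ := hA
    have hcount : (Oracle.ev :: t).count Oracle.ev = t.count Oracle.ev + 1 := by simp
    have hcount' : (Oracle.ev :: t).count Oracle.ro = t.count Oracle.ro := by simp
    rw [hcount] at hS ⊢
    rw [hcount']
    have h : ∀ x, _ := fun x => ih t ht (insert x S)
      (by have := Finset.card_insert_le x S; omega) (Ψ.evQuery x) (Family.evQuery_setEv hΨ x)
    have h1 := fun x => hybridSum_evQuery_branch_le hd S next Ψ hΨ x
    have h2 : idealSum (.evQuery next) Ψ = ∑ x, idealSum next (Ψ.evQuery x) := by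
      simp only [idealSum, acceptProb]
      exact Finset.sum_comm
    have h3 := Finset.sum_le_sum fun x (_ : x ∈ Finset.univ) => add_le_add (h x) (h1 x)
    simp only [Finset.sum_add_distrib, Finset.sum_sub_distrib, ← Finset.mul_sum, ← Finset.sum_div,
      Family.sum_weight_evQuery, Family.sum_influence_evQuery, ← hybridSum_evQuery, ← h2] at h3
    have h4 : 0 ≤ d * (t.count Oracle.ro * Ψ.weight) := by
      have := Ψ.weight_nonneg
      positivity
    push_cast
    linarith

theorem le_two_mul_sqrt_mul {a u v : ℝ} (hu : 0 ≤ u) (hv : 0 ≤ v)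
    (h : ∀ c : ℝ, 0 < c → a ≤ c * u + v / c) : a ≤ 2 * (√u * √v) := by
  -- The optimal `c = √v / √u` is not available if `u` or `v` vanishes, so perturb it by `ε`.
  have key : ∀ ε : ℝ, 0 < ε → a ≤ 2 * (√u * √v) + ε * (√u + √v) := by
    intro ε hε
    have hu' : 0 < √u + ε := by positivity
    have hv' : 0 < √v + ε := by positivity
    refine (h ((√v + ε) / (√u + ε)) (by positivity)).trans ?_
    have h1 : (√v + ε) / (√u + ε) * u ≤ (√v + ε) * √u := by
      rw [div_mul_eq_mul_div, div_le_iff₀ hu']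
      nlinarith [Real.mul_self_sqrt hu, mul_nonneg (mul_nonneg hv'.le hε.le) (Real.sqrt_nonneg u)]
    have h2 : v / ((√v + ε) / (√u + ε)) ≤ (√u + ε) * √v := by
      rw [div_div_eq_mul_div, div_le_iff₀ hv']
      nlinarith [Real.mul_self_sqrt hv, mul_nonneg (mul_nonneg hu'.le hε.le) (Real.sqrt_nonneg v)]
    linarith
  have ht : Filter.Tendsto (fun ε : ℝ => 2 * (√u * √v) + ε * (√u + √v)) (nhdsWithin 0 (Set.Ioi 0))
      (nhds (2 * (√u * √v) + 0 * (√u + √v))) := by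
    refine Filter.Tendsto.mono_left (Continuous.tendsto ?_ 0) nhdsWithin_le_nhds
    fun_prop
  rw [zero_mul, add_zero] at ht
  exact ge_of_tendsto ht (by filter_upwards [self_mem_nhdsWithin] with ε hε using key ε hε)

end Hybrid

/-! ### The advantage against `FFX` -/

section Advantage

variable {w k n m : ℕ}

theorem prfAdvantage_FFX_eq (A : Adversary w k n m n m) :
    2 ^ (k + n) * Fintype.card (World k n m) * prfAdvantage (FFX k n m) A =
      hybridSum ∅ A (fun _ => initState) - 2 ^ (k + n) * idealSum A (fun _ => initState) := by
  have hF : (Fintype.card (Bits n → Bits m) : ℝ) ≠ 0 := by exact_mod_cast Fintype.card_ne_zero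
  have hH : (Fintype.card (Fcs k n m) : ℝ) ≠ 0 := by exact_mod_cast Fintype.card_ne_zero
  have hK : (Fintype.card (Bits (k + n)) : ℝ) = 2 ^ (k + n) := by simp [ZMod.card]
  have hW : (Fintype.card (World k n m) : ℝ) =
      Fintype.card (Fcs k n m) * Fintype.card (Bits n → Bits m) := by
    rw [Fintype.card_prod, Nat.cast_mul]
  have h1 : prfGame (FFX k n m) true A =
      hybridSum ∅ A (fun _ => initState) / (2 ^ (k + n) * Fintype.card (World k n m)) := by
    simp only [prfGame, hybridSum, reprogram_empty, if_true, Fintype.expect_eq_sum_div_card,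
      Fintype.sum_prod_type (α₁ := Fcs k n m), Finset.sum_const, Finset.card_univ, nsmul_eq_mul,
      ← Finset.sum_div, ← Finset.mul_sum, hW, hK]
    rw [Finset.sum_comm]
    field_simp
  have h0 : prfGame (FFX k n m) false A =
      idealSum A (fun _ => initState) / Fintype.card (World k n m) := by
    simp only [prfGame, idealSum, Fintype.expect_eq_sum_div_card, Bool.false_eq_true, if_false,
      Fintype.sum_prod_type (α₁ := Fcs k n m), Finset.sum_const, Finset.card_univ, nsmul_eq_mul,
      ← Finset.sum_div, ← Finset.mul_sum, hW, hK]
    field_simp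
  rw [prfAdvantage, h1, h0, hW]
  field_simp

theorem prfAdvantage_FFX_le {p q : ℕ} (A : Adversary w k n m n m) (hA : A.OrderConsistent p q)
    {c d : ℝ} (hc : 0 < c) (hd : 0 < d) :
    prfAdvantage (FFX k n m) A ≤
      (c * (p * q / 2 ^ (k + n)) + p / c) + (d * (p * q / 2 ^ (k + n)) + q / d) := by
  obtain ⟨s, hs, rfl, rfl⟩ := hA
  have h := hybridSum_sub_idealSum_le hc hd (s.count Oracle.ev) A s hs ∅ (by simp)
    (fun _ => initState) (fun _ _ _ _ => rfl)
  have hw : Family.weight (fun _ : World k n m => (initState : QState w k n m n m)) =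
      Fintype.card (World k n m) := by
    simp only [Family.weight, sqNorm_initState, Finset.sum_const, Finset.card_univ, nsmul_eq_mul,
      mul_one]
  have hi : Family.influence (fun _ : World k n m => (initState : QState w k n m n m)) = 0 := by
    simp [Family.influence, sqNorm]
  have hM : (0 : ℝ) < Fintype.card (World k n m) := by exact_mod_cast Fintype.card_pos
  rw [← prfAdvantage_FFX_eq, hw, hi] at h
  have hN : (0 : ℝ) < 2 ^ (k + n) * Fintype.card (World k n m) := by positivity
  refine le_of_mul_le_mul_left (h.trans_eq ?_) hN
  field_simp
  ring

end Advantage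

theorem mainTheorem2 (w k n m p q : ℕ) (A : Adversary w k n m n m)
    (hA : A.OrderConsistent p q) :
    prfAdvantage (FFX k n m) A ≤
      Real.sqrt (8 * ((p : ℝ) + q) * p * q / 2 ^ (k + n)) := by
  set u : ℝ := p * q / 2 ^ (k + n) with hu
  have hu0 : 0 ≤ u := by positivity
  have h : prfAdvantage (FFX k n m) A ≤ 2 * (√u * √p) + 2 * (√u * √q) := by
    have h1 : ∀ c : ℝ, 0 < c → prfAdvantage (FFX k n m) A - (c * u + p / c) ≤ 2 * (√u * √q) :=
      fun c hc => le_two_mul_sqrt_mul hu0 (Nat.cast_nonneg q) fun d hd => by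
        linarith [prfAdvantage_FFX_le A hA hc hd]
    have h2 : prfAdvantage (FFX k n m) A - 2 * (√u * √q) ≤ 2 * (√u * √p) :=
      le_two_mul_sqrt_mul hu0 (Nat.cast_nonneg p) fun c hc => by linarith [h1 c hc]
    linarith
  refine h.trans (Real.le_sqrt_of_sq_le ?_)
  have e : 8 * ((p : ℝ) + q) * p * q / 2 ^ (k + n) = 8 * (p + q) * u := by rw [hu]; ring
  have su := Real.sq_sqrt hu0
  have sp := Real.sq_sqrt (Nat.cast_nonneg (α := ℝ) p)
  have sq := Real.sq_sqrt (Nat.cast_nonneg (α := ℝ) q)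
  rw [e, ← su, ← sp, ← sq, Real.sqrt_sq (Real.sqrt_nonneg _), Real.sqrt_sq (Real.sqrt_nonneg _),
    Real.sqrt_sq (Real.sqrt_nonneg _)]
  nlinarith [mul_nonneg (sq_nonneg √u) (sq_nonneg (√(p : ℝ) - √(q : ℝ)))]
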